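/- Let $M\cong\mathbb Z^n$ be a lattice, $M_{\mathbb R}=M\otimes_{\mathbb Z}\mathbb R$, and let $T=\operatorname{Hom}_{\mathbb Z}(M,\mathbb C^\times)$; for $m\in M$ and $t\in T$ write $m(t)\in\mathbb C^\times$ for the value of $t$ at $m$. Let $\Box\subset M_{\mathbb R}$ be a convex polytope (a bounded intersection of finitely many affine half-spaces) whose set of extreme points $\operatorname{ext}\Box$ is contained in $M$. For $\alpha\in\operatorname{ext}\Box$ let $C_\alpha=\{r(v-\alpha): r\ge 0,\ v\in\Box\}$ be the tangent cone, and let the edge vectors of $\Box$ at $\alpha$ be the shortest nonzero vectors of $M$ on the extreme rays of $C_\alpha$. Assume that $\Box$ is basic at every $\alpha\in\operatorname{ext}\Box$, that is, $C_\alpha$ is generated as a cone by part of a $\mathbb Z$-basis of $M$. Then $\Box\cap M$ and $\operatorname{ext}\Box$ are finite, at every $\alpha\in\operatorname{ext}\Box$ there are exactly $d=\dim\Box$ edge vectors $\lambda_\alpha^1,\dots,\lambda_\alpha^d$ (so $d=n$ if $\Box$ is full-dimensional), and $$\sum_{m\in\Box\cap M} m(t)=\sum_{\alpha\in\operatorname{ext}\Box}\frac{\alpha(t)}{(1-\lambda_\alpha^1(t))\cdots(1-\lambda_\alpha^d(t))}$$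 for every $t\in T$ such that $\lambda_\alpha^i(t)\neq 1$ for all $\alpha\in\operatorname{ext}\Box$ and all $i=1,\dots,d$. -/

import Mathlib

namespace LatticePolytope

variable {V : Type*} [NormedAddCommGroup V] [NormedSpace ℝ V]

/-- A convex polytope: a bounded intersection of finitely many closed affine half-spaces. -/
def IsConvexPolytope (P : Set V) : Prop :=
  (∃ H : Finset (Module.Dual ℝ V × ℝ), P = {v | ∀ h ∈ H, h.2 ≤ h.1 v}) ∧
    Bornology.IsBounded P

/-- A polytope on the lattice `L`: a convex polytope all of whose extreme points lie in `L`. -/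
def IsPolytopeOn (L : Submodule ℤ V) (P : Set V) : Prop :=
  IsConvexPolytope P ∧ P.extremePoints ℝ ⊆ (L : Set V)

/-- The extreme points of `P` that lie in `L`, as elements of `L`
(all the extreme points, if `P` is a polytope on `L`). -/
def vertices (L : Submodule ℤ V) (P : Set V) : Set L :=
  {α | (α : V) ∈ P.extremePoints ℝ}

/-- The points of `L` in `P`, as elements of `L`. -/
def latticePoints (L : Submodule ℤ V) (P : Set V) : Set L :=
  {m | (m : V) ∈ P}

/-- The tangent cone `ℝ≥0 (P - α)`. -/
def tangentCone (P : Set V) (α : V) : Set V :=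
  {w | ∃ r : ℝ, 0 ≤ r ∧ ∃ v ∈ P, w = r • (v - α)}

/-- A cone is basic with respect to `L` if it is generated, as a cone, by a part of a
`ℤ`-basis of `L`. -/
def IsBasicCone (L : Submodule ℤ V) (C : Set V) : Prop :=
  ∃ (b : Module.Basis (Fin (Module.finrank ℤ L)) ℤ L) (s : Set (Fin (Module.finrank ℤ L))),
    C = (PointedCone.hull ℝ ((fun i => (b i : V)) '' s) : Set V)

/-- The ray `ℝ≥0 l`. -/
def ray (l : V) : Set V := {w | ∃ r : ℝ, 0 ≤ r ∧ w = r • l}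

/-- The edge vectors of `P` at `α`, i.e. the shortest generators in `L` of the tangent cone:
the nonzero `l ∈ L` that span an extreme ray of the cone and are the shortest
nonzero lattice vectors on that ray. -/
def edgeVectors (L : Submodule ℤ V) (P : Set V) (α : V) : Set L :=
  {l | l ≠ 0 ∧ IsExtreme ℝ (tangentCone P α) (ray (l : V)) ∧
    ∀ m : L, m ≠ 0 → (m : V) ∈ ray (l : V) → ∃ r : ℝ, 1 ≤ r ∧ (m : V) = r • (l : V)}

/-- The complex torus of characters `L → ℂˣ`. -/
abbrev Torus (L : Submodule ℤ V) : Type _ := Multiplicative L →* ℂˣ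

/-- The value `m(t)` of the lattice element `m` at the point `t` of the torus. -/
def ev {L : Submodule ℤ V} (m : L) (t : Torus L) : ℂ :=
  ((t (Multiplicative.ofAdd m) : ℂˣ) : ℂ)

end LatticePolytope

namespace LatticePolytope

variable {V : Type*} [NormedAddCommGroup V] [NormedSpace ℝ V] {ι : Type*}

/-! The formula is the Brianchon–Gram relation evaluated at `t`. By `brianchon_gram`, the indicator
function of `P` is the alternating sum, with signs `(-1) ^ dim F`, of the indicator functions of the
tangent cones `faceCone P F` along all faces. Restricted to the lattice, these functions are mostly
not finitely supported, so sums are replaced by the regularized value `HasValue`: multiply by an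
element `q` of the group algebra with `q(t) ≠ 0` that makes the support finite, evaluate, and divide
by `q(t)`. This value is linear, and it is the ordinary sum on finitely supported functions
(`HasValue.eq_sum_of_indicator`). A cone along a face of positive dimension is invariant under an
edge vector `λ` with `λ(t) ≠ 1`, so its value is `0`; the cone at a vertex is a lattice orthant,
whose value is a product of geometric series (`hasValue_orthant`). Only the vertex terms survive.

For Brianchon–Gram at a point `x`, a generic quotient of affine functions assigns to each face the
vertex where it is smallest. Basicness makes the faces through a vertex `v` correspond to sets `S`
of generators. Those assigned to `v` are the subsets of the increasing set `U`, and their cones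
contain `x` exactly when `S` contains the set `A` of negative coordinates of `x - v` (and `x - v`
lies in the span of the generators). The signed count vanishes unless `A = U`. If `x ∈ P`, then `A =
∅` and only the vertex with `U = ∅`, the maximum, counts. If `x ∉ P`, the denominator is chosen to
vanish at `x`, and `A = U` never occurs. -/

/-- The nonempty closed convex extreme subsets of `P`. -/
def faces (P : Set V) : Set (Set V) :=
  {F | IsExtreme ℝ P F ∧ Convex ℝ F ∧ IsClosed F ∧ F.Nonempty}

/-- The (affine) tangent cone of `P` along the face `F`. -/
def faceCone (P F : Set V) : Set V :=
  {x | ∃ y ∈ F, ∃ z ∈ F, ∃ p ∈ P, ∃ r : ℝ, 0 ≤ r ∧ x = y + r • (p - z)}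

/-- A coordinate system adapted to the tangent cone of `P` at `v`: a basis of the ambient space
such that a part of it generates the tangent cone. -/
structure VertexFrame (ι : Type*) (P : Set V) (v : V) where
  /-- The basis of the ambient space. -/
  basis : Module.Basis ι ℝ V
  /-- The indices of the generators of the tangent cone. -/
  gens : Finset ι
  mem_tangentCone_iff : ∀ w, w ∈ tangentCone P v ↔
    (∀ i ∈ gens, 0 ≤ basis.coord i w) ∧ ∀ i ∉ gens, basis.coord i w = 0

theorem eq_sum_coord_smul (B : Module.Basis ι ℝ V) (S : Finset ι) {w : V}
    (hw : ∀ i ∉ S, B.coord i w = 0) : w = ∑ i ∈ S, B.coord i w • B i := by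
  conv_lhs => rw [← B.linearCombination_repr w, Finsupp.linearCombination_apply]
  refine Finsupp.sum_of_support_subset _ (fun i hi => ?_) _ (by simp)
  by_contra h
  exact Finsupp.mem_support_iff.1 hi (hw i h)

/-! ### Moving from a point inside a convex set. -/

theorem sub_mem_tangentCone {P : Set V} {v x : V} (hx : x ∈ P) : x - v ∈ tangentCone P v :=
  ⟨1, zero_le_one, x, hx, by simp⟩

theorem add_smul_mem_of_le {F : Set V} (hF : Convex ℝ F) {v w : V} (hv : v ∈ F) {r s : ℝ}
    (hr : v + r • w ∈ F) (hs : 0 ≤ s) (hsr : s ≤ r) : v + s • w ∈ F := by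
  rcases eq_or_lt_of_le (hs.trans hsr) with h | h
  · have : s = 0 := le_antisymm (h ▸ hsr) hs
    simpa [this] using hv
  · have := hF.add_smul_sub_mem hv hr (t := s / r) ⟨by positivity, (div_le_one h).2 hsr⟩
    rwa [add_sub_cancel_left, smul_smul, div_mul_cancel₀ _ h.ne'] at this

/-- Small multiples of tangent vectors stay in `P`. -/
theorem exists_add_smul_mem {P : Set V} (hP : Convex ℝ P) {v w : V} (hv : v ∈ P)
    (hw : w ∈ tangentCone P v) : ∃ ε : ℝ, 0 < ε ∧ ∀ s, 0 ≤ s → s ≤ ε → v + s • w ∈ P := by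
  obtain ⟨r, hr, p, hp, rfl⟩ := hw
  refine ⟨1 / (r + 1), by positivity, fun s hs hs' => ?_⟩
  rw [smul_smul]
  refine hP.add_smul_sub_mem hv hp ⟨by positivity, ?_⟩
  rw [le_div_iff₀ (by positivity)] at hs'
  nlinarith

/-- The directions in which one can move from `v` inside a convex set are closed under nonnegative
linear combinations. -/
theorem exists_add_smul_sum_mem {F : Set V} (hF : Convex ℝ F) {v : V} (hv : v ∈ F)
    (S : Finset ι) (e : ι → V) (c : ι → ℝ) (hc : ∀ i ∈ S, 0 ≤ c i)
    (he : ∀ i ∈ S, ∃ r : ℝ, 0 < r ∧ v + r • e i ∈ F) :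
    ∃ r : ℝ, 0 < r ∧ v + r • ∑ i ∈ S, c i • e i ∈ F := by
  classical
  induction S using Finset.induction_on with
  | empty => exact ⟨1, one_pos, by simpa using hv⟩
  | insert j S hj ih =>
    obtain ⟨r, hr, hrF⟩ := ih (fun i hi => hc i (Finset.mem_insert_of_mem hi))
      (fun i hi => he i (Finset.mem_insert_of_mem hi))
    obtain ⟨s, hs, hsF⟩ := he j (Finset.mem_insert_self _ _)
    have hcj := hc j (Finset.mem_insert_self _ _)
    -- The `+ 1` covers `c j = 0`. Averaging the two points reached with parameter `q` gives the sum
    -- with parameter `q / 2`.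
    set q := min r (s / (c j + 1)) with hq
    have hq0 : 0 < q := lt_min hr (by positivity)
    have h1 := add_smul_mem_of_le hF hv hrF hq0.le (min_le_left _ _)
    have h2 : v + (q * c j) • e j ∈ F := by
      refine add_smul_mem_of_le hF hv hsF (by positivity) ?_
      have : q ≤ s / (c j + 1) := min_le_right _ _
      rw [le_div_iff₀ (by positivity)] at this
      nlinarith
    refine ⟨q / 2, by positivity, ?_⟩
    have := hF h1 h2 (a := 1 / 2) (b := 1 / 2) (by norm_num) (by norm_num) (by norm_num)
    convert this using 1
    rw [Finset.sum_insert hj]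
    module

/-! ### Faces through a vertex correspond to sets of generators. -/

namespace VertexFrame

variable {P : Set V} {v : V} (Φ : VertexFrame ι P v)

theorem coord_sub_nonneg {x : V} (hx : x ∈ P) (i : ι) : 0 ≤ Φ.basis.coord i (x - v) := by
  have h := (Φ.mem_tangentCone_iff _).1 (sub_mem_tangentCone hx)
  by_cases hi : i ∈ Φ.gens
  · exact h.1 i hi
  · exact (h.2 i hi).ge

theorem coord_sub_eq_zero {x : V} (hx : x ∈ P) {i : ι} (hi : i ∉ Φ.gens) :
    Φ.basis.coord i (x - v) = 0 :=
  ((Φ.mem_tangentCone_iff _).1 (sub_mem_tangentCone hx)).2 i hi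

theorem coord_basis [DecidableEq ι] (i j : ι) :
    Φ.basis.coord i (Φ.basis j) = if i = j then 1 else 0 := by
  simp [Finsupp.single_apply, eq_comm]

theorem basis_mem_tangentCone {i : ι} (hi : i ∈ Φ.gens) : Φ.basis i ∈ tangentCone P v := by
  classical
  rw [Φ.mem_tangentCone_iff]
  refine ⟨fun j _ => ?_, fun j hj => ?_⟩
  · rw [coord_basis]; split_ifs <;> simp
  · rw [coord_basis, if_neg]; rintro rfl; exact hj hi

theorem eq_sum_of_coord_eq_zero (S : Finset ι) {w : V}
    (hw : ∀ i ∉ S, Φ.basis.coord i w = 0) : w = ∑ i ∈ S, Φ.basis.coord i w • Φ.basis i :=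
  eq_sum_coord_smul Φ.basis S hw

open Classical in
/-- The generators of the tangent cone at `v` that point into `F`. -/
noncomputable def dirs (F : Set V) : Finset ι :=
  Φ.gens.filter fun i => ∃ r : ℝ, 0 < r ∧ v + r • Φ.basis i ∈ F

theorem mem_dirs {F : Set V} {i : ι} :
    i ∈ Φ.dirs F ↔ i ∈ Φ.gens ∧ ∃ r : ℝ, 0 < r ∧ v + r • Φ.basis i ∈ F := by
  simp [dirs]

theorem dirs_subset (F : Set V) : Φ.dirs F ⊆ Φ.gens := fun _ hi => (Φ.mem_dirs.1 hi).1

/-- The face at `v` spanned by the directions in `S`. -/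
def faceOf (S : Finset ι) : Set V := {x ∈ P | ∀ i ∉ S, Φ.basis.coord i (x - v) = 0}

/-- If the coordinate `c` were positive, `x - v` would split into the tangent vectors `c • b i` and
`(x - v) - c • b i`. Small steps along these two have their midpoint in `F`, and extremality then
puts a point `v + r • b i` in `F`. -/
theorem coord_eq_zero_of_mem_face (hP : Convex ℝ P) {F : Set V} (hF : F ∈ faces P) (hv : v ∈ F)
    {x : V} (hx : x ∈ F) {i : ι} (hi : i ∉ Φ.dirs F) : Φ.basis.coord i (x - v) = 0 := by
  classical
  obtain ⟨hext, hconv, -, -⟩ := hF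
  by_cases hg : i ∈ Φ.gens
  swap
  · exact Φ.coord_sub_eq_zero (hext.subset hx) hg
  by_contra hne
  set c := Φ.basis.coord i (x - v) with hc
  have hpos : 0 < c := lt_of_le_of_ne (Φ.coord_sub_nonneg (hext.subset hx) i) (Ne.symm hne)
  have hw : (x - v) - c • Φ.basis i ∈ tangentCone P v := by
    rw [Φ.mem_tangentCone_iff]
    refine ⟨fun j _ => ?_, fun j hj => ?_⟩
    · rw [map_sub, map_smul, coord_basis]
      split_ifs with h
      · subst h; simp [hc]
      · simpa using Φ.coord_sub_nonneg (hext.subset hx) j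
    · rw [map_sub, map_smul, coord_basis, if_neg (by rintro rfl; exact hj hg),
        Φ.coord_sub_eq_zero (hext.subset hx) hj]
      simp
  obtain ⟨ε, hε, h1⟩ := exists_add_smul_mem hP (hext.subset hv) hw
  obtain ⟨δ, hδ, h2⟩ := exists_add_smul_mem hP (hext.subset hv) (Φ.basis_mem_tangentCone hg)
  set q := min (min ε (δ / c)) 1 with hq
  have hq0 : 0 < q := lt_min (lt_min hε (by positivity)) one_pos
  have hq1 : q ≤ ε := (min_le_left _ _).trans (min_le_left _ _)
  have hq2 : q * c ≤ δ := by
    rw [← le_div_iff₀ hpos]; exact (min_le_left _ _).trans (min_le_right _ _)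
  have hq3 : q ≤ 1 := min_le_right _ _
  have hmid : v + (q / 2) • (x - v) ∈ F :=
    hconv.add_smul_sub_mem hv hx ⟨by positivity, by linarith⟩
  have hmem := hext.left_mem_of_mem_openSegment (h2 (q * c) (by positivity) hq2)
    (h1 q hq0.le hq1) hmid
    ⟨1 / 2, 1 / 2, by norm_num, by norm_num, by norm_num, by module⟩
  exact hi (Φ.mem_dirs.2 ⟨hg, q * c, by positivity, hmem⟩)

/-- For the nontrivial inclusion, convexity of `F` gives a small step from `v` towards `x` that
stays in `F`; this point lies strictly between `x` and `v`, so extremality returns `x`. -/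
theorem face_eq_faceOf_dirs (hP : Convex ℝ P) {F : Set V} (hF : F ∈ faces P) (hv : v ∈ F) :
    F = Φ.faceOf (Φ.dirs F) := by
  refine Set.Subset.antisymm (fun x hx =>
    ⟨hF.1.subset hx, fun i hi => Φ.coord_eq_zero_of_mem_face hP hF hv hx hi⟩) ?_
  rintro x ⟨hx, hx0⟩
  obtain ⟨hext, hconv, -, -⟩ := hF
  obtain ⟨r, hr, hrF⟩ := exists_add_smul_sum_mem hconv hv (Φ.dirs F) Φ.basis
    (fun i => Φ.basis.coord i (x - v)) (fun i _ => Φ.coord_sub_nonneg hx i)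
    (fun i hi => (Φ.mem_dirs.1 hi).2)
  rw [← Φ.eq_sum_of_coord_eq_zero _ hx0] at hrF
  have hq := add_smul_mem_of_le hconv hv hrF (s := min r (1 / 2))
    (le_min hr.le (by norm_num)) (min_le_left _ _)
  set q := min r (1 / 2 : ℝ)
  have hq0 : 0 < q := lt_min hr (by norm_num)
  have hq1 : q ≤ 1 / 2 := min_le_right _ _
  exact hext.left_mem_of_mem_openSegment hx (hext.subset hv) hq
    ⟨q, 1 - q, hq0, by linarith, by ring, by module⟩

theorem faceOf_mem_faces [FiniteDimensional ℝ V] (hP : Convex ℝ P) (hc : IsClosed P) (hv : v ∈ P)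
    (S : Finset ι) : Φ.faceOf S ∈ faces P := by
  refine ⟨⟨fun x hx => hx.1, ?_⟩, ?_, ?_, ⟨v, hv, by simp⟩⟩
  · rintro x hx y hy z ⟨hz, hz0⟩ ⟨a, b, ha, hb, hab, rfl⟩
    refine ⟨hx, fun i hi => ?_⟩
    have h := hz0 i hi
    have : a • x + b • y - v = a • (x - v) + b • (y - v) := by
      rw [show b = 1 - a by linarith]; module
    rw [this, map_add, map_smul, map_smul, smul_eq_mul, smul_eq_mul] at h
    have h1 := Φ.coord_sub_nonneg hx i
    have h2 := Φ.coord_sub_nonneg hy i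
    nlinarith [mul_nonneg hb.le h2, mul_nonneg ha.le h1]
  · rintro x ⟨hx, hx0⟩ y ⟨hy, hy0⟩ a b ha hb hab
    refine ⟨hP hx hy ha hb hab, fun i hi => ?_⟩
    have : a • x + b • y - v = a • (x - v) + b • (y - v) := by
      rw [show b = 1 - a by linarith]; module
    rw [this, map_add, map_smul, map_smul, hx0 i hi, hy0 i hi]
    simp
  · have : Φ.faceOf S = P ∩ ⋂ i, ⋂ (_ : i ∉ S), {x | Φ.basis.coord i (x - v) = 0} := by
      ext x; simp [faceOf]
    rw [this]
    refine hc.inter (isClosed_iInter fun i => isClosed_iInter fun _ => ?_)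
    have hcont : Continuous (Φ.basis.coord i) := LinearMap.continuous_of_finiteDimensional _
    exact isClosed_eq (hcont.comp (continuous_id.sub continuous_const)) continuous_const

/-- Together with `face_eq_faceOf_dirs`, this makes faces through `v` and subsets of the generators
correspond bijectively. -/
theorem dirs_faceOf (hP : Convex ℝ P) (hv : v ∈ P) {S : Finset ι} (hS : S ⊆ Φ.gens) :
    Φ.dirs (Φ.faceOf S) = S := by
  classical
  ext i
  rw [mem_dirs]
  constructor
  · rintro ⟨hg, r, hr, -, h⟩
    by_contra hi
    have := h i hi
    rw [add_sub_cancel_left, map_smul, coord_basis, if_pos rfl] at this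
    simp at this
    exact hr.ne' this
  · intro hi
    obtain ⟨ε, hε, h⟩ := exists_add_smul_mem hP hv (Φ.basis_mem_tangentCone (hS hi))
    refine ⟨hS hi, ε, hε, h ε hε.le le_rfl, fun j hj => ?_⟩
    rw [add_sub_cancel_left, map_smul, coord_basis, if_neg (by rintro rfl; exact hj hi)]
    simp

/-- Directions along `F` become lines in the cone, so exactly their sign conditions disappear. -/
theorem mem_faceCone_iff (hP : Convex ℝ P) {F : Set V} (hF : F ∈ faces P) (hv : v ∈ F) {x : V} :
    x ∈ faceCone P F ↔ (∀ i ∉ Φ.gens, Φ.basis.coord i (x - v) = 0) ∧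
      ∀ i ∈ Φ.gens, i ∉ Φ.dirs F → 0 ≤ Φ.basis.coord i (x - v) := by
  classical
  have hvP : v ∈ P := hF.1.subset hv
  constructor
  · rintro ⟨y, hy, z, hz, p, hp, r, hr, rfl⟩
    have key : ∀ i ∉ Φ.dirs F, Φ.basis.coord i (y + r • (p - z) - v) =
        r * Φ.basis.coord i (p - v) := by
      intro i hi
      rw [show y + r • (p - z) - v = (y - v) + r • ((p - v) - (z - v)) by module, map_add,
        map_smul, map_sub _ (p - v), Φ.coord_eq_zero_of_mem_face hP hF hv hy hi,
        Φ.coord_eq_zero_of_mem_face hP hF hv hz hi]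
      simp
    refine ⟨fun i hi => ?_, fun i _ hi => ?_⟩
    · rw [key i fun h => hi (Φ.dirs_subset F h), Φ.coord_sub_eq_zero hp hi, mul_zero]
    · rw [key i hi]
      exact mul_nonneg hr (Φ.coord_sub_nonneg hp i)
  · rintro ⟨h0, hpos⟩
    -- Adding `w₁`, a combination of directions of `F`, makes every coordinate of `x - v`
    -- nonnegative; after scaling, it is subtracted again as the point `z` of `F`.
    set w₁ := ∑ i ∈ Φ.dirs F, |Φ.basis.coord i (x - v)| • Φ.basis i with hw₁
    have hcoord : ∀ j, Φ.basis.coord j w₁ =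
        if j ∈ Φ.dirs F then |Φ.basis.coord j (x - v)| else 0 := by
      intro j
      rw [hw₁, map_sum]
      simp only [map_smul, coord_basis, smul_eq_mul, mul_ite, mul_one, mul_zero]
      rw [Finset.sum_ite_eq]
    have hw : (x - v) + w₁ ∈ tangentCone P v := by
      rw [Φ.mem_tangentCone_iff]
      refine ⟨fun i hi => ?_, fun i hi => ?_⟩
      · rw [map_add, hcoord]
        split_ifs with h
        · linarith [neg_abs_le (Φ.basis.coord i (x - v))]
        · simpa using hpos i hi h
      · rw [map_add, hcoord, if_neg fun h => hi (Φ.dirs_subset F h), h0 i hi, add_zero]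
    obtain ⟨ε, hε, hεP⟩ := exists_add_smul_mem hP hvP hw
    obtain ⟨δ, hδ, hδF⟩ := exists_add_smul_sum_mem hF.2.1 hv (Φ.dirs F) Φ.basis
      (fun i => |Φ.basis.coord i (x - v)|) (fun i _ => abs_nonneg _)
      (fun i hi => (Φ.mem_dirs.1 hi).2)
    have hq0 : 0 < min ε δ := lt_min hε hδ
    refine ⟨v, hv, _, add_smul_mem_of_le hF.2.1 hv hδF hq0.le (min_le_right _ _), _,
      hεP (min ε δ) hq0.le (min_le_left _ _), (min ε δ)⁻¹, by positivity, ?_⟩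
    rw [← hw₁, show v + min ε δ • (x - v + w₁) - (v + min ε δ • w₁) = min ε δ • (x - v) by module,
      smul_smul, inv_mul_cancel₀ hq0.ne']
    module

theorem finrank_vectorSpan (hP : Convex ℝ P) {F : Set V} (hF : F ∈ faces P) (hv : v ∈ F) :
    Module.finrank ℝ (vectorSpan ℝ F) = (Φ.dirs F).card := by
  have : vectorSpan ℝ F = Submodule.span ℝ (Φ.basis '' (Φ.dirs F : Set ι)) := by
    rw [vectorSpan_eq_span_vsub_set_right ℝ hv]
    refine le_antisymm (Submodule.span_le.2 ?_) (Submodule.span_le.2 ?_)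
    · rintro _ ⟨x, hx, rfl⟩
      simp only [vsub_eq_sub]
      rw [Φ.eq_sum_of_coord_eq_zero (Φ.dirs F)
        fun i hi => Φ.coord_eq_zero_of_mem_face hP hF hv hx hi]
      exact Submodule.sum_mem _ fun i hi =>
        Submodule.smul_mem _ _ (Submodule.subset_span ⟨i, hi, rfl⟩)
    · rintro _ ⟨i, hi, rfl⟩
      obtain ⟨-, r, hr, h⟩ := Φ.mem_dirs.1 hi
      have := Submodule.smul_mem _ r⁻¹
        (Submodule.subset_span (R := ℝ) (Set.mem_image_of_mem (· -ᵥ v) h))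
      simpa [smul_smul, inv_mul_cancel₀ hr.ne'] using this
  rw [this, Set.image_eq_range, finrank_span_eq_card]
  · simp
  · exact Φ.basis.linearIndependent.comp _ Subtype.val_injective

theorem dirs_self (hP : Convex ℝ P) (hv : v ∈ P) : Φ.dirs P = Φ.gens :=
  Finset.Subset.antisymm (Φ.dirs_subset P) fun i hi => by
    obtain ⟨ε, hε, h⟩ := exists_add_smul_mem hP hv (Φ.basis_mem_tangentCone hi)
    exact Φ.mem_dirs.2 ⟨hi, ε, hε, h ε hε.le le_rfl⟩

theorem isExtreme_ray {i : ι} (hi : i ∈ Φ.gens) :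
    IsExtreme ℝ (tangentCone P v) (ray (Φ.basis i)) := by
  classical
  refine ⟨?_, ?_⟩
  · rintro _ ⟨r, hr, rfl⟩
    obtain ⟨s, hs, p, hp, h⟩ := Φ.basis_mem_tangentCone hi
    exact ⟨r * s, mul_nonneg hr hs, p, hp, by rw [h, smul_smul]⟩
  · rintro x hx y hy _ ⟨r, hr, rfl⟩ ⟨c, d, hc, hd, -, h⟩
    rw [Φ.mem_tangentCone_iff] at hx hy
    refine ⟨Φ.basis.coord i x, hx.1 i hi, ?_⟩
    have := Φ.eq_sum_of_coord_eq_zero {i} (w := x) fun j hj => ?_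
    · simpa using this
    by_cases hjg : j ∈ Φ.gens
    · have h' := congrArg (Φ.basis.coord j) h
      rw [map_add, map_smul, map_smul, map_smul, Φ.coord_basis,
        if_neg (by simpa using hj)] at h'
      simp only [smul_eq_mul, mul_zero] at h'
      have h1 := mul_nonneg hc.le (hx.1 j hjg)
      have h2 := mul_nonneg hd.le (hy.1 j hjg)
      exact (mul_eq_zero.1 (by linarith : c * Φ.basis.coord j x = 0)).resolve_left hc.ne'
    · exact hx.2 j hjg

theorem eq_singleton_of_dirs_eq_empty (hconv : Convex ℝ P) {F : Set V}
    (hF : F ∈ faces P) (hv : v ∈ F) (hd : Φ.dirs F = ∅) : F = {v} := by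
  refine Set.eq_singleton_iff_unique_mem.2 ⟨hv, fun x hx => ?_⟩
  have := Φ.eq_sum_of_coord_eq_zero (Φ.dirs F)
    fun i hi => Φ.coord_eq_zero_of_mem_face hconv hF hv hx hi
  rwa [hd, Finset.sum_empty, sub_eq_zero] at this

end VertexFrame

/-- The alternating sum over the sets between `A` and `U` vanishes unless `A = U`. -/
theorem sum_powerset_filter_neg_one_pow_card [DecidableEq ι] {A U : Finset ι} (h : A ≠ U) :
    ∑ S ∈ U.powerset, (if A ⊆ S then (-1 : ℤ) ^ S.card else 0) = 0 := by
  by_cases hAU : A ⊆ U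
  swap
  · refine Finset.sum_eq_zero fun S hS => if_neg fun hA => hAU ?_
    exact hA.trans (Finset.mem_powerset.1 hS)
  -- Toggling an element `j` of `U` outside `A` pairs the sets `S` with opposite signs.
  obtain ⟨j, hjU, hjA⟩ := Finset.exists_of_ssubset (hAU.ssubset_of_ne h)
  rw [← Finset.insert_erase hjU, Finset.sum_powerset_insert (Finset.notMem_erase j U),
    ← Finset.sum_add_distrib]
  refine Finset.sum_eq_zero fun S hS => ?_
  have hjS : j ∉ S := fun hj => Finset.notMem_erase j U (Finset.mem_powerset.1 hS hj)
  have : A ⊆ insert j S ↔ A ⊆ S := by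
    rw [Finset.subset_insert_iff, Finset.erase_eq_of_notMem hjA]
  simp only [this, Finset.card_insert_of_notMem hjS]
  split_ifs <;> ring

/-! ### Faces are determined by their vertices (Krein–Milman). -/

section Faces

variable {P : Set V}

theorem self_mem_faces (hconv : Convex ℝ P) (hclosed : IsClosed P) (hne : P.Nonempty) :
    P ∈ faces P := ⟨IsExtreme.refl ℝ P, hconv, hclosed, hne⟩

theorem extremePoints_of_mem_faces {F : Set V} (hF : F ∈ faces P) :
    F.extremePoints ℝ = F ∩ P.extremePoints ℝ := hF.1.extremePoints_eq

theorem exists_extremePoint_mem_face (hcomp : IsCompact P) {F : Set V} (hF : F ∈ faces P) :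
    ∃ v ∈ F, v ∈ P.extremePoints ℝ := by
  have hFc : IsCompact F := hcomp.of_isClosed_subset hF.2.2.1 hF.1.subset
  obtain ⟨v, hv⟩ := hFc.extremePoints_nonempty hF.2.2.2
  rw [extremePoints_of_mem_faces hF] at hv
  exact ⟨v, hv⟩

theorem face_eq_closure_convexHull (hcomp : IsCompact P) {F : Set V} (hF : F ∈ faces P) :
    closure (convexHull ℝ (F ∩ P.extremePoints ℝ)) = F := by
  rw [← extremePoints_of_mem_faces hF]
  exact closure_convexHull_extremePoints (hcomp.of_isClosed_subset hF.2.2.1 hF.1.subset) hF.2.1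

theorem finite_faces (hcomp : IsCompact P) (hfin : (P.extremePoints ℝ).Finite) :
    (faces P).Finite := by
  refine Set.Finite.of_finite_image (f := fun F => F ∩ P.extremePoints ℝ)
    (hfin.finite_subsets.subset ?_) fun F hF G hG h => ?_
  · rintro _ ⟨F, -, rfl⟩
    exact Set.inter_subset_right
  · rw [← face_eq_closure_convexHull hcomp hF, ← face_eq_closure_convexHull hcomp hG]
    exact congrArg (fun s => closure (convexHull ℝ s)) h

/-- A linear inequality on the vertices of a face holds on the whole face. -/
theorem le_apply_of_mem_face [FiniteDimensional ℝ V] (hcomp : IsCompact P) {F : Set V}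
    (hF : F ∈ faces P) (f : V →ₗ[ℝ] ℝ) (c : ℝ)
    (h : ∀ v ∈ F, v ∈ P.extremePoints ℝ → c ≤ f v) {x : V} (hx : x ∈ F) : c ≤ f x := by
  rw [← face_eq_closure_convexHull hcomp hF] at hx
  have hcont : Continuous f := LinearMap.continuous_of_finiteDimensional _
  refine closure_minimal (t := {x | c ≤ f x}) (convexHull_min ?_ ?_)
    (isClosed_le continuous_const hcont) hx
  · rintro v ⟨hv, hv'⟩
    exact h v hv hv'
  · exact convex_halfSpace_ge f.isLinear c

end Faces

/-! ### The Brianchon–Gram relation by a generic linear-fractional function. -/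

/-- The slope at `v`, up to a positive factor, of the quotient of the affine functions
`p ↦ Ξ (p, 1)` and `p ↦ e p + β` in the direction `l`. -/
def slope (Ξ : V × ℝ →ₗ[ℝ] ℝ) (e : V →ₗ[ℝ] ℝ) (β : ℝ) (v : V) : V →ₗ[ℝ] ℝ :=
  (e v + β) • Ξ ∘ₗ LinearMap.inl ℝ V ℝ - Ξ (v, 1) • e

theorem slope_sub (Ξ : V × ℝ →ₗ[ℝ] ℝ) (e : V →ₗ[ℝ] ℝ) (β : ℝ) (v p : V) :
    slope Ξ e β v (p - v) = (e v + β) * Ξ (p, 1) - Ξ (v, 1) * (e p + β) := by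
  have : Ξ (p - v, 0) = Ξ (p, 1) - Ξ (v, 1) := by rw [← map_sub]; simp
  have h : slope Ξ e β v (p - v) = (e v + β) * Ξ (p - v, 0) - Ξ (v, 1) * e (p - v) := rfl
  rw [h, this, map_sub]
  ring

/-- Exhibits the slope as `Ξ` at a vector independent of `Ξ`, so genericity means that `Ξ` avoids
finitely many hyperplanes. -/
theorem slope_apply_eq (Ξ : V × ℝ →ₗ[ℝ] ℝ) (e : V →ₗ[ℝ] ℝ) (β : ℝ) (v l : V) :
    slope Ξ e β v l = Ξ ((e v + β) • l - e l • v, -e l) := by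
  have : ((e v + β) • l - e l • v, -e l) = (e v + β) • ((l, 0) : V × ℝ) - e l • (v, 1) := by
    ext <;> simp
  rw [this, map_sub, map_smul, map_smul]
  simp [slope, mul_comm]

theorem slope_neg (Ξ : V × ℝ →ₗ[ℝ] ℝ) (e : V →ₗ[ℝ] ℝ) (β : ℝ) (v l : V) :
    slope (-Ξ) e β v l = -slope Ξ e β v l := by
  simp [slope_apply_eq]

section Frames

variable {P : Set V} (Φ : ∀ v : P.extremePoints ℝ, VertexFrame ι P (v : V))

/-- The generators at `v` in the direction of which the quotient of the two affine functions
increases. -/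
noncomputable def increasing (Ξ : V × ℝ →ₗ[ℝ] ℝ) (e : V →ₗ[ℝ] ℝ) (β : ℝ)
    (v : P.extremePoints ℝ) : Finset ι :=
  (Φ v).gens.filter fun i => 0 < slope Ξ e β (v : V) ((Φ v).basis i)

theorem increasing_subset (Ξ : V × ℝ →ₗ[ℝ] ℝ) (e : V →ₗ[ℝ] ℝ) (β : ℝ) (v : P.extremePoints ℝ) :
    increasing Φ Ξ e β v ⊆ (Φ v).gens := Finset.filter_subset _ _

/-- Every face has exactly one vertex at which a generic quotient of affine functions is
minimal. -/
theorem existsUnique_dirs_subset_increasing [FiniteDimensional ℝ V] (hcomp : IsCompact P)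
    (hconv : Convex ℝ P) (hfin : (P.extremePoints ℝ).Finite)
    (Ξ : V × ℝ →ₗ[ℝ] ℝ) (e : V →ₗ[ℝ] ℝ) (β : ℝ) (hpos : ∀ p ∈ P, 0 < e p + β)
    (hgen : ∀ v : P.extremePoints ℝ, ∀ i ∈ (Φ v).gens, slope Ξ e β (v : V) ((Φ v).basis i) ≠ 0)
    {F : Set V} (hF : F ∈ faces P) :
    ∃! v : P.extremePoints ℝ, (v : V) ∈ F ∧ (Φ v).dirs F ⊆ increasing Φ Ξ e β v := by
  obtain ⟨v₀, hv₀F, hv₀⟩ := exists_extremePoint_mem_face hcomp hF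
  obtain ⟨w, hw, hmin⟩ := Set.exists_min_image (F ∩ P.extremePoints ℝ)
    (fun p => Ξ (p, 1) / (e p + β)) (hfin.subset Set.inter_subset_right) ⟨v₀, hv₀F, hv₀⟩
  -- After clearing denominators, minimality at `w` is a linear inequality on the vertices, hence
  -- holds on all of `F`.
  have hslope : ∀ p ∈ F, 0 ≤ slope Ξ e β w (p - w) := by
    intro p hp
    have := le_apply_of_mem_face hcomp hF (slope Ξ e β w) (slope Ξ e β w w)
      (fun v hvF hv => ?_) hp
    · rw [map_sub]; linarith
    · have h := hmin v ⟨hvF, hv⟩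
      rw [div_le_div_iff₀ (hpos w (hF.1.subset hw.1)) (hpos v (hF.1.subset hvF))] at h
      have h2 := slope_sub Ξ e β w v
      rw [map_sub] at h2
      linarith
  refine ⟨⟨w, hw.2⟩, ⟨hw.1, fun i hi => ?_⟩, ?_⟩
  · obtain ⟨hg, r, hr, hrF⟩ := (Φ ⟨w, hw.2⟩).mem_dirs.1 hi
    refine Finset.mem_filter.2 ⟨hg, lt_of_le_of_ne ?_ (hgen ⟨w, hw.2⟩ i hg).symm⟩
    have := hslope _ hrF
    rw [add_sub_cancel_left, map_smul, smul_eq_mul] at this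
    exact nonneg_of_mul_nonneg_right this hr
  · rintro v ⟨hvF, hv⟩
    by_contra hne
    have hne' : w ≠ v := fun h => hne (Subtype.ext h.symm)
    have h1 := (Φ v).eq_sum_of_coord_eq_zero ((Φ v).dirs F)
      fun i hi => (Φ v).coord_eq_zero_of_mem_face hconv hF hvF hw.1 hi
    -- From `v`, the point `w` is reached along increasing directions only. But by `slope_sub` this
    -- slope is the negative of the slope at `w` towards `v`, which is nonnegative.
    have h2 : 0 < slope Ξ e β v (w - v) := by
      rw [h1, map_sum]
      have hnn : ∀ i ∈ (Φ v).dirs F, 0 ≤ slope Ξ e β (v : V)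
          ((Φ v).basis.coord i (w - v) • (Φ v).basis i) := fun i hi => by
        rw [map_smul, smul_eq_mul]
        exact mul_nonneg ((Φ v).coord_sub_nonneg (hF.1.subset hw.1) i)
          (Finset.mem_filter.1 (hv hi)).2.le
      refine lt_of_le_of_ne (Finset.sum_nonneg hnn) fun h0 => hne' ?_
      rw [eq_comm, Finset.sum_eq_zero_iff_of_nonneg hnn] at h0
      rw [← sub_eq_zero, h1]
      refine Finset.sum_eq_zero fun i hi => ?_
      have h3 := h0 i hi
      rw [map_smul, smul_eq_mul] at h3
      rw [(mul_eq_zero.1 h3).resolve_right (Finset.mem_filter.1 (hv hi)).2.ne', zero_smul]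
    have h3 := hslope v hvF
    rw [slope_sub] at h2 h3
    linarith

/-- The alternating sum over the faces whose tangent cone contains `x`, regrouped according to
a choice of a vertex of each face. -/
theorem sum_faces_eq_sum_vertices [FiniteDimensional ℝ V] [Fintype (P.extremePoints ℝ)]
    [DecidableEq ι] (hcomp : IsCompact P) (hconv : Convex ℝ P) (hfaces : (faces P).Finite)
    (U : P.extremePoints ℝ → Finset ι) (hU : ∀ v, U v ⊆ (Φ v).gens)
    (huniq : ∀ F ∈ faces P, ∃! v : P.extremePoints ℝ, (v : V) ∈ F ∧ (Φ v).dirs F ⊆ U v)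
    (g : Set V → ℤ) :
    ∑ F ∈ hfaces.toFinset, g F = ∑ v, ∑ S ∈ (U v).powerset, g ((Φ v).faceOf S) := by
  rw [Finset.sum_sigma']
  have hmem : ∀ v : P.extremePoints ℝ, (v : V) ∈ P := fun v => v.2.1
  have hdirs : ∀ (v : P.extremePoints ℝ) (S : Finset ι), S ⊆ U v →
      (Φ v).dirs ((Φ v).faceOf S) = S := fun v S hS =>
    (Φ v).dirs_faceOf hconv (hmem v) (hS.trans (hU v))
  symm
  refine Finset.sum_bij (fun a _ => (Φ a.1).faceOf a.2) ?_ ?_ ?_ fun _ _ => rfl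
  · rintro ⟨v, S⟩ -
    exact hfaces.mem_toFinset.2 ((Φ v).faceOf_mem_faces hconv hcomp.isClosed (hmem v) S)
  · rintro ⟨v, S⟩ hS ⟨w, T⟩ hT h
    simp only [Finset.mem_sigma, Finset.mem_univ, Finset.mem_powerset, true_and] at hS hT h
    have hF := (Φ v).faceOf_mem_faces hconv hcomp.isClosed (hmem v) S
    have hvw : v = w := by
      refine (huniq _ hF).unique ⟨⟨hmem v, by simp⟩, ?_⟩ ⟨?_, ?_⟩
      · rwa [hdirs v S hS]
      · rw [h]; exact ⟨hmem w, by simp⟩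
      · rwa [h, hdirs w T hT]
    subst hvw
    rw [← hdirs v S hS, h, hdirs v T hT]
  · intro F hF
    rw [Set.Finite.mem_toFinset] at hF
    obtain ⟨v, ⟨hvF, hv⟩, -⟩ := huniq F hF
    exact ⟨⟨v, (Φ v).dirs F⟩, by simpa using hv, ((Φ v).face_eq_faceOf_dirs hconv hF hvF).symm⟩

/-- The contribution of the faces assigned to the vertex `v`. -/
theorem sum_powerset_faceCone [FiniteDimensional ℝ V] [DecidableEq ι] (hclosed : IsClosed P)
    (hconv : Convex ℝ P) (v : P.extremePoints ℝ) {U : Finset ι} (hU : U ⊆ (Φ v).gens) (x : V)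
    [∀ F : Set V, Decidable (x ∈ faceCone P F)]
    [Decidable (∀ i ∉ (Φ v).gens, (Φ v).basis.coord i (x - v) = 0)] :
    ∑ S ∈ U.powerset, (if x ∈ faceCone P ((Φ v).faceOf S) then
      (-1 : ℤ) ^ Module.finrank ℝ (vectorSpan ℝ ((Φ v).faceOf S)) else 0) =
    if ∀ i ∉ (Φ v).gens, (Φ v).basis.coord i (x - v) = 0 then
      ∑ S ∈ U.powerset, (if ((Φ v).gens.filter fun i => (Φ v).basis.coord i (x - v) < 0) ⊆ S then
        (-1 : ℤ) ^ S.card else 0) else 0 := by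
  have hv : (v : V) ∈ P := v.2.1
  have key : ∀ S ∈ U.powerset, (x ∈ faceCone P ((Φ v).faceOf S) ↔
      (∀ i ∉ (Φ v).gens, (Φ v).basis.coord i (x - v) = 0) ∧
      ((Φ v).gens.filter fun i => (Φ v).basis.coord i (x - v) < 0) ⊆ S) ∧
      Module.finrank ℝ (vectorSpan ℝ ((Φ v).faceOf S)) = S.card := by
    intro S hS
    have hSg := (Finset.mem_powerset.1 hS).trans hU
    have hF := (Φ v).faceOf_mem_faces hconv hclosed hv S
    have hvF : (v : V) ∈ (Φ v).faceOf S := ⟨hv, by simp⟩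
    rw [(Φ v).mem_faceCone_iff hconv hF hvF, (Φ v).finrank_vectorSpan hconv hF hvF,
      (Φ v).dirs_faceOf hconv hv hSg]
    refine ⟨and_congr_right fun _ => ?_, rfl⟩
    simp only [Finset.subset_iff, Finset.mem_filter, and_imp]
    refine forall₂_congr fun i _ => ?_
    rw [← not_lt, not_imp_not]
  split_ifs with h
  · refine Finset.sum_congr rfl fun S hS => ?_
    rw [(key S hS).2]
    exact if_congr ((key S hS).1.trans (and_iff_right h)) rfl rfl
  · exact Finset.sum_eq_zero fun S hS => if_neg fun hx => h ((key S hS).1.1 hx).1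

/-- A functional can avoid finitely many nonzero vectors; replacing `Ξ` by `-Ξ` fixes the sign at
`(x, 1)`. The slope vectors are nonzero because, when `e` vanishes on the generator, the first
component is a positive multiple of it. -/
theorem exists_generic [FiniteDimensional ℝ V] [Finite (P.extremePoints ℝ)] [Finite ι]
    (e : V →ₗ[ℝ] ℝ) (β : ℝ) (hpos : ∀ p ∈ P, 0 < e p + β) (x : V) :
    ∃ Ξ : V × ℝ →ₗ[ℝ] ℝ, 0 < Ξ (x, 1) ∧ ∀ v : P.extremePoints ℝ, ∀ i,
      slope Ξ e β (v : V) ((Φ v).basis i) ≠ 0 := by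
  let u : Option (P.extremePoints ℝ × ι) → V × ℝ := fun o => o.elim (x, 1) fun a =>
    ((e a.1 + β) • (Φ a.1).basis a.2 - e ((Φ a.1).basis a.2) • (a.1 : V), -e ((Φ a.1).basis a.2))
  obtain ⟨Ξ, hΞ⟩ := Module.exists_dual_forall_apply_ne_zero (K := ℝ) u (by
    rintro (_ | ⟨v, i⟩) h
    · simpa [u] using congrArg Prod.snd h
    · have h2 := congrArg Prod.snd h
      have h1 := congrArg Prod.fst h
      simp only [u, Option.elim, Prod.snd_zero, neg_eq_zero, Prod.fst_zero] at h1 h2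
      rw [h2, zero_smul, sub_zero] at h1
      exact (smul_ne_zero (hpos v v.2.1).ne' ((Φ v).basis.ne_zero i)) h1)
  have hx : Ξ (x, 1) ≠ 0 := hΞ none
  have hs : ∀ v : P.extremePoints ℝ, ∀ i, slope Ξ e β (v : V) ((Φ v).basis i) ≠ 0 := fun v i => by
    rw [slope_apply_eq]; exact hΞ (some (v, i))
  rcases lt_or_gt_of_ne hx with h | h
  · refine ⟨-Ξ, by simpa using h, fun v i => ?_⟩
    rw [slope_neg]
    exact neg_ne_zero.2 (hs v i)
  · exact ⟨Ξ, h, hs⟩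

/-- The Brianchon–Gram relation for a polytope with simplicial tangent cones. -/
theorem brianchon_gram [FiniteDimensional ℝ V] [Finite ι]
    (Φ : ∀ v : P.extremePoints ℝ, VertexFrame ι P (v : V)) (hcomp : IsCompact P)
    (hconv : Convex ℝ P) (hfin : (P.extremePoints ℝ).Finite) (hfaces : (faces P).Finite) (x : V)
    [∀ F : Set V, Decidable (x ∈ faceCone P F)] [Decidable (x ∈ P)] :
    ∑ F ∈ hfaces.toFinset, (if x ∈ faceCone P F then
      (-1 : ℤ) ^ Module.finrank ℝ (vectorSpan ℝ F) else 0) = if x ∈ P then 1 else 0 := by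
  classical
  have := hfin.fintype
  split_ifs with hx
  -- The constant denominator `1` suffices here; `w` below minimizes `-Ξ`, so it is the unique
  -- vertex with no increasing generator.
  · have hpos : ∀ p ∈ P, (0 : ℝ) < (0 : V →ₗ[ℝ] ℝ) p + 1 := by simp
    obtain ⟨Ξ, -, hgen⟩ := exists_generic Φ 0 1 hpos x
    rw [sum_faces_eq_sum_vertices Φ hcomp hconv hfaces (increasing Φ Ξ 0 1)
      (increasing_subset Φ _ _ _) (fun F hF => existsUnique_dirs_subset_increasing Φ hcomp
        hconv hfin Ξ 0 1 hpos (fun v i _ => hgen v i) hF)]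
    obtain ⟨w, ⟨-, hw⟩, hw'⟩ := existsUnique_dirs_subset_increasing Φ hcomp hconv hfin (-Ξ) 0 1
      hpos (fun v i _ => by rw [slope_neg]; exact neg_ne_zero.2 (hgen v i))
      (self_mem_faces hconv hcomp.isClosed ⟨x, hx⟩)
    have hempty : ∀ v : P.extremePoints ℝ, increasing Φ Ξ 0 1 v = ∅ ↔
        (Φ v).dirs P ⊆ increasing Φ (-Ξ) 0 1 v := by
      intro v
      rw [(Φ v).dirs_self hconv v.2.1]
      simp only [increasing, Finset.filter_eq_empty_iff, Finset.subset_iff, Finset.mem_filter,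
        slope_neg, neg_pos]
      refine forall₂_congr fun i hi => ?_
      rw [not_lt, and_iff_right hi]
      exact ⟨fun h => lt_of_le_of_ne h (hgen v i), le_of_lt⟩
    have hneg : ∀ v : P.extremePoints ℝ,
        ((Φ v).gens.filter fun i => (Φ v).basis.coord i (x - v) < 0) = ∅ := fun v =>
      Finset.filter_eq_empty_iff.2 fun i _ => not_lt.2 ((Φ v).coord_sub_nonneg hx i)
    rw [Finset.sum_eq_single w]
    · rw [sum_powerset_faceCone Φ hcomp.isClosed hconv w (increasing_subset Φ _ _ _ _),
        if_pos fun i hi => (Φ w).coord_sub_eq_zero hx hi, (hempty w).2 hw, hneg w]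
      simp
    · intro v _ hvw
      rw [sum_powerset_faceCone Φ hcomp.isClosed hconv v (increasing_subset Φ _ _ _ _),
        if_pos fun i hi => (Φ v).coord_sub_eq_zero hx hi, hneg v]
      exact sum_powerset_filter_neg_one_pow_card fun h =>
        hvw (hw' v ⟨v.2.1, (hempty v).1 h.symm⟩)
    · simp
  -- The separating functional gives the denominator `f - f x`, positive on `P` and zero at `x`.
  · obtain ⟨f, c, hfx, hfP⟩ := geometric_hahn_banach_point_closed hconv hcomp.isClosed hx
    have hpos : ∀ p ∈ P, (0 : ℝ) < (f : V →ₗ[ℝ] ℝ) p + -f x := fun p hp => by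
      have := hfP p hp
      simp only [ContinuousLinearMap.coe_coe]
      linarith
    obtain ⟨Ξ, hΞx, hgen⟩ := exists_generic Φ _ _ hpos x
    rw [sum_faces_eq_sum_vertices Φ hcomp hconv hfaces (increasing Φ Ξ f (-f x))
      (increasing_subset Φ _ _ _) (fun F hF => existsUnique_dirs_subset_increasing Φ hcomp
        hconv hfin Ξ _ _ hpos (fun v i _ => hgen v i) hF)]
    refine Finset.sum_eq_zero fun v _ => ?_
    rw [sum_powerset_faceCone Φ hcomp.isClosed hconv v (increasing_subset Φ _ _ _ _)]
    split_ifs with h0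
    swap
    · rfl
    refine sum_powerset_filter_neg_one_pow_card fun h => ?_
    -- If `A = U`, coordinate and slope never have the same strict sign. Yet this slope equals `(f v
    -- - f x) * Ξ (x, 1)`, which is positive.
    have h1 : slope Ξ f (-f x) v (x - v) ≤ 0 := by
      rw [(Φ v).eq_sum_of_coord_eq_zero _ h0, map_sum]
      refine Finset.sum_nonpos fun i hi => ?_
      rw [map_smul, smul_eq_mul]
      have h2 := Finset.ext_iff.1 h i
      simp only [increasing, Finset.mem_filter, hi, true_and] at h2
      rcases lt_or_ge ((Φ v).basis.coord i (x - v)) 0 with h3 | h3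
      · exact mul_nonpos_of_nonpos_of_nonneg h3.le (h2.1 h3).le
      · exact mul_nonpos_of_nonneg_of_nonpos h3 (not_lt.1 fun h4 => (h2.2 h4).not_ge h3)
    rw [slope_sub] at h1
    have h2 := mul_pos (hpos v v.2.1) hΞx
    simp only [ContinuousLinearMap.coe_coe] at h1 h2
    linarith

end Frames

/-! ### Regularized values of functions on a group. -/

section Regularization

variable {G : Type*} [AddCommGroup G]

/-- The translation action of `G` on functions. -/
noncomputable def translation : Multiplicative G →* Module.End ℂ (G → ℂ) where
  toFun g := LinearMap.funLeft ℂ ℂ fun m => m - g.toAdd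
  map_one' := by ext f; simp [LinearMap.funLeft]
  map_mul' g h := by
    refine LinearMap.ext fun f => funext fun m => ?_
    simp [LinearMap.funLeft, sub_sub]

/-- The action of the group algebra on functions on `G` by convolution. -/
noncomputable def convolution : AddMonoidAlgebra ℂ G →ₐ[ℂ] Module.End ℂ (G → ℂ) :=
  AddMonoidAlgebra.lift ℂ (Module.End ℂ (G → ℂ)) G translation

/-- The value of an element of the group algebra at a character. -/
noncomputable def evalChar (t : Multiplicative G →* ℂˣ) : AddMonoidAlgebra ℂ G →ₐ[ℂ] ℂ :=
  AddMonoidAlgebra.lift ℂ ℂ G ((Units.coeHom ℂ).comp t)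

theorem convolution_single (g : G) (f : G → ℂ) (m : G) :
    convolution (AddMonoidAlgebra.single g 1) f m = f (m - g) := by
  simp [convolution, translation, LinearMap.funLeft]

theorem evalChar_single (t : Multiplicative G →* ℂˣ) (g : G) (r : ℂ) :
    evalChar t (AddMonoidAlgebra.single g r) = r * (t (Multiplicative.ofAdd g) : ℂ) := by
  simp [evalChar]

theorem convolution_coeff (q p : AddMonoidAlgebra ℂ G) :
    convolution q p.coeff = (q * p).coeff := by
  classical
  induction q using AddMonoidAlgebra.induction_linear with
  | zero => simp
  | add q₁ q₂ h₁ h₂ => simp [add_mul, h₁, h₂]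
  | single g r =>
    have h : (AddMonoidAlgebra.single g r : AddMonoidAlgebra ℂ G) =
      r • AddMonoidAlgebra.single g 1 := by simp
    funext m
    rw [h, map_smul, LinearMap.smul_apply, Pi.smul_apply, convolution_single]
    rw [smul_mul_assoc, AddMonoidAlgebra.coeff_smul, Finsupp.smul_apply]
    rw [AddMonoidAlgebra.coeff_single_mul_apply, one_mul, neg_add_eq_sub]

/-- The function `f` has the regularized value `z` at the character `t`: some `q` in the group
algebra that does not vanish at `t` turns `f` into an element `p` of the group algebra,
and `z = p(t) / q(t)`. -/
def HasValue (t : Multiplicative G →* ℂˣ) (f : G → ℂ) (z : ℂ) : Prop :=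
  ∃ q p : AddMonoidAlgebra ℂ G, evalChar t q ≠ 0 ∧ convolution q f = p.coeff ∧
    evalChar t p = evalChar t q * z

variable {t : Multiplicative G →* ℂˣ}

theorem hasValue_coeff (p : AddMonoidAlgebra ℂ G) : HasValue t p.coeff (evalChar t p) :=
  ⟨1, p, by simp, by simp, by simp⟩

/-- On finitely supported functions convolution is the product of the group algebra, and evaluation
at `t` is multiplicative, so the choice of `q` cancels. -/
theorem HasValue.eq_evalChar {p : AddMonoidAlgebra ℂ G} {z : ℂ} (h : HasValue t p.coeff z) :
    z = evalChar t p := by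
  obtain ⟨q, p', hq, hp', hz⟩ := h
  rw [convolution_coeff] at hp'
  have : q * p = p' := AddMonoidAlgebra.coeff_injective (DFunLike.coe_injective hp')
  rw [← this, map_mul] at hz
  exact (mul_left_cancel₀ hq hz).symm

theorem HasValue.add {f₁ f₂ : G → ℂ} {z₁ z₂ : ℂ} (h₁ : HasValue t f₁ z₁)
    (h₂ : HasValue t f₂ z₂) : HasValue t (f₁ + f₂) (z₁ + z₂) := by
  obtain ⟨q₁, p₁, hq₁, hp₁, hz₁⟩ := h₁
  obtain ⟨q₂, p₂, hq₂, hp₂, hz₂⟩ := h₂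
  refine ⟨q₁ * q₂, q₂ * p₁ + q₁ * p₂, ?_, ?_, ?_⟩
  · rw [map_mul]; exact mul_ne_zero hq₁ hq₂
  · have e₁ : convolution (q₁ * q₂) f₁ = convolution q₂ p₁.coeff := by
      rw [mul_comm, map_mul, Module.End.mul_apply, hp₁]
    have e₂ : convolution (q₁ * q₂) f₂ = convolution q₁ p₂.coeff := by
      rw [map_mul, Module.End.mul_apply, hp₂]
    rw [map_add, AddMonoidAlgebra.coeff_add, Finsupp.coe_add, ← convolution_coeff,
      ← convolution_coeff, e₁, e₂]
  · simp only [map_add, map_mul, hz₁, hz₂]; ring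

theorem HasValue.smul {f : G → ℂ} {z : ℂ} (h : HasValue t f z) (c : ℂ) :
    HasValue t (c • f) (c * z) := by
  obtain ⟨q, p, hq, hp, hz⟩ := h
  refine ⟨q, c • p, hq, ?_, ?_⟩
  · rw [map_smul, hp]; simp
  · rw [map_smul, hz, smul_eq_mul]; ring

theorem hasValue_zero : HasValue t (0 : G → ℂ) 0 := ⟨1, 0, by simp, by simp, by simp⟩

theorem HasValue.sum {κ : Type*} (s : Finset κ) {f : κ → G → ℂ} {z : κ → ℂ}
    (h : ∀ k ∈ s, HasValue t (f k) (z k)) : HasValue t (∑ k ∈ s, f k) (∑ k ∈ s, z k) := by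
  classical
  induction s using Finset.induction_on with
  | empty => simpa using hasValue_zero
  | insert k s hk ih =>
    rw [Finset.sum_insert hk, Finset.sum_insert hk]
    exact (h k (Finset.mem_insert_self _ _)).add
      (ih fun j hj => h j (Finset.mem_insert_of_mem hj))

/-- The abstract geometric series: `1 - [g]` carries `f` to `f'`, and its value at `t` is nonzero.
-/
theorem HasValue.of_sub_translate {f f' : G → ℂ} {z : ℂ} {g : G} (h : HasValue t f' z)
    (hf : ∀ m, f m - f (m - g) = f' m) (hg : (t (Multiplicative.ofAdd g) : ℂ) ≠ 1) :
    HasValue t f (z / (1 - t (Multiplicative.ofAdd g))) := by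
  obtain ⟨q, p, hq, hp, hz⟩ := h
  have hg' : 1 - (t (Multiplicative.ofAdd g) : ℂ) ≠ 0 := sub_ne_zero.2 hg.symm
  have hval : evalChar t (1 - AddMonoidAlgebra.single g 1) = 1 - t (Multiplicative.ofAdd g) := by
    rw [map_sub, map_one, evalChar_single, one_mul]
  refine ⟨q * (1 - AddMonoidAlgebra.single g 1), p, ?_, ?_, ?_⟩
  · rw [map_mul, hval]; exact mul_ne_zero hq hg'
  · rw [map_mul, Module.End.mul_apply, ← hp]
    congr 1
    funext m
    rw [map_sub, map_one, ← hf, LinearMap.sub_apply, Pi.sub_apply, convolution_single]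
    rfl
  · rw [map_mul, hval, hz]; field_simp

theorem hasValue_zero_of_invariant {f : G → ℂ} {g : G} (hf : ∀ m, f (m - g) = f m)
    (hg : (t (Multiplicative.ofAdd g) : ℂ) ≠ 1) : HasValue t f 0 := by
  simpa using hasValue_zero.of_sub_translate (t := t) (f := f) (g := g) (by simp [hf]) hg

theorem hasValue_indicator_finite (S : Finset G) [DecidablePred (· ∈ S)] :
    HasValue t (fun m => if m ∈ S then 1 else 0) (∑ m ∈ S, (t (Multiplicative.ofAdd m) : ℂ)) := by
  classical
  have := HasValue.sum (t := t) S fun m _ => hasValue_coeff (AddMonoidAlgebra.single m (1 : ℂ))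
  simp only [evalChar_single, one_mul] at this
  convert this using 1
  funext m
  simp [Finset.sum_apply, Finsupp.single_apply]

/-- The value of the indicator function of a finite set of elements of `G` is unique. -/
theorem HasValue.eq_sum_of_indicator {S : Finset G} [DecidablePred (· ∈ S)] {z : ℂ}
    (h : HasValue t (fun m => if m ∈ S then 1 else 0) z) :
    z = ∑ m ∈ S, (t (Multiplicative.ofAdd m) : ℂ) := by
  classical
  have hS : (fun m => if m ∈ S then (1 : ℂ) else 0) =
      (∑ m ∈ S, AddMonoidAlgebra.single m (1 : ℂ)).coeff := by
    funext m
    simp [Finsupp.single_apply]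
  rw [hS] at h
  rw [h.eq_evalChar, map_sum]
  simp [evalChar_single]

open Classical in
/-- The value of the indicator function of a translated orthant spanned by a part `s` of a basis. -/
theorem hasValue_orthant {κ : Type*} (b : Module.Basis κ ℤ G) (s : Finset κ) (α : G)
    (ht : ∀ i ∈ s, (t (Multiplicative.ofAdd (b i)) : ℂ) ≠ 1) :
    HasValue t (fun m => if (∀ i ∈ s, 0 ≤ b.repr (m - α) i) ∧ ∀ i ∉ s, b.repr (m - α) i = 0
        then 1 else 0)
      ((t (Multiplicative.ofAdd α) : ℂ) / ∏ i ∈ s, (1 - (t (Multiplicative.ofAdd (b i)) : ℂ))) := by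
  induction s using Finset.induction_on with
  | empty =>
    have := hasValue_indicator_finite (t := t) {α}
    simp only [Finset.sum_singleton, Finset.mem_singleton] at this
    convert this using 1
    · funext m
      refine if_congr ?_ rfl rfl
      simp only [Finset.notMem_empty, false_implies, implies_true, true_and, not_false_eq_true,
        true_implies]
      rw [← sub_eq_zero (a := m) (b := α), ← LinearEquiv.map_eq_zero_iff b.repr]
      exact (Finsupp.ext_iff (f := b.repr (m - α)) (g := 0)).symm
    · simp
  | insert j s hj ih =>
    -- An orthant minus its translate by `b j` is the slice where coordinate `j` vanishes, which is
    -- the orthant of `s`.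
    have h := (ih fun i hi => ht i (Finset.mem_insert_of_mem hi)).of_sub_translate
      (f := fun m => if (∀ i ∈ insert j s, 0 ≤ b.repr (m - α) i) ∧
        ∀ i ∉ insert j s, b.repr (m - α) i = 0 then 1 else 0) (g := b j) ?_
      (ht j (Finset.mem_insert_self _ _))
    · rw [Finset.prod_insert hj]
      convert h using 1
      rw [div_div, mul_comm]
    · intro m
      have hne : ∀ i, i ≠ j → b.repr (m - b j - α) i = b.repr (m - α) i := fun i hi => by
        rw [show m - b j - α = (m - α) - b j by abel, map_sub, Finsupp.sub_apply, b.repr_self,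
          Finsupp.single_eq_of_ne hi, sub_zero]
      have hjj : b.repr (m - b j - α) j = b.repr (m - α) j - 1 := by
        rw [show m - b j - α = (m - α) - b j by abel, map_sub, Finsupp.sub_apply, b.repr_self,
          Finsupp.single_eq_same]
      have hA : ∀ c : G, ((∀ i ∈ insert j s, 0 ≤ b.repr c i) ∧ ∀ i ∉ insert j s, b.repr c i = 0) ↔
          0 ≤ b.repr c j ∧ (∀ i ∈ s, 0 ≤ b.repr c i) ∧ ∀ i ∉ s, i ≠ j → b.repr c i = 0 := by
        intro c
        constructor
        · rintro ⟨h1, h2⟩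
          exact ⟨h1 j (Finset.mem_insert_self _ _), fun i hi => h1 i (Finset.mem_insert_of_mem hi),
            fun i hi hij => h2 i (by simp [hi, hij])⟩
        · rintro ⟨h0, h1, h2⟩
          refine ⟨fun i hi => ?_, fun i hi => ?_⟩
          · rcases Finset.mem_insert.1 hi with rfl | hi
            exacts [h0, h1 i hi]
          · rw [Finset.mem_insert, not_or] at hi
            exact h2 i hi.2 hi.1
      have hB : ((∀ i ∈ s, 0 ≤ b.repr (m - α) i) ∧ ∀ i ∉ s, b.repr (m - α) i = 0) ↔
          b.repr (m - α) j = 0 ∧ (∀ i ∈ s, 0 ≤ b.repr (m - α) i) ∧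
            ∀ i ∉ s, i ≠ j → b.repr (m - α) i = 0 := by
        constructor
        · rintro ⟨h1, h2⟩
          exact ⟨h2 j hj, h1, fun i hi _ => h2 i hi⟩
        · rintro ⟨h0, h1, h2⟩
          refine ⟨h1, fun i hi => ?_⟩
          by_cases hij : i = j
          · rw [hij, h0]
          · exact h2 i hi hij
      have hC : ((∀ i ∈ s, 0 ≤ b.repr (m - b j - α) i) ∧
            ∀ i ∉ s, i ≠ j → b.repr (m - b j - α) i = 0) ↔
          (∀ i ∈ s, 0 ≤ b.repr (m - α) i) ∧ ∀ i ∉ s, i ≠ j → b.repr (m - α) i = 0 := by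
        refine and_congr (forall₂_congr fun i hi => ?_) (forall₃_congr fun i _ hij => ?_)
        · rw [hne i (by rintro rfl; exact hj hi)]
        · rw [hne i hij]
      simp only [hA, hB, hC, hjj]
      by_cases hR : (∀ i ∈ s, 0 ≤ b.repr (m - α) i) ∧ ∀ i ∉ s, i ≠ j → b.repr (m - α) i = 0
      · simp only [and_iff_left hR]
        rcases lt_trichotomy (b.repr (m - α) j) 0 with h | h | h
        · rw [if_neg (by omega), if_neg (by omega), if_neg (by omega), sub_zero]
        · rw [if_pos (by omega), if_neg (by omega), if_pos (by omega), sub_zero]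
        · rw [if_pos (by omega), if_pos (by omega), if_neg (by omega), sub_self]
      · simp only [hR, and_false, if_false, sub_zero]

end Regularization

/-! ### Polytopes, their lattice points, and cones in coordinates. -/

theorem IsConvexPolytope.convex {P : Set V} (hP : IsConvexPolytope P) : Convex ℝ P := by
  obtain ⟨⟨H, rfl⟩, -⟩ := hP
  simp only [Set.ofPred_forall]
  exact convex_iInter₂ fun h _ => convex_halfSpace_ge h.1.isLinear h.2

theorem IsConvexPolytope.isCompact [FiniteDimensional ℝ V] {P : Set V}
    (hP : IsConvexPolytope P) : IsCompact P := by
  have : ProperSpace V := FiniteDimensional.proper ℝ V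
  obtain ⟨⟨H, rfl⟩, hb⟩ := hP
  refine Metric.isCompact_of_isClosed_isBounded ?_ hb
  simp only [Set.ofPred_forall]
  exact isClosed_biInter fun h _ =>
    isClosed_le continuous_const (LinearMap.continuous_of_finiteDimensional h.1)

theorem finite_latticePoints [FiniteDimensional ℝ V] (L : Submodule ℤ V) [DiscreteTopology L]
    {P : Set V} (hP : Bornology.IsBounded P) : (latticePoints L P).Finite := by
  have : ProperSpace V := FiniteDimensional.proper ℝ V
  have hL : IsClosed (L : Set V) := by
    rw [← Submodule.coe_toAddSubgroup]
    have : DiscreteTopology L.toAddSubgroup := inferInstanceAs (DiscreteTopology L)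
    exact AddSubgroup.isClosed_of_discrete
  have h : (P ∩ (L : Set V)).Finite :=
    Metric.finite_isBounded_inter_isClosed DiscreteTopology.isDiscrete hP hL
  refine Set.Finite.of_finite_image (f := Subtype.val) (h.subset ?_) Subtype.val_injective.injOn
  rintro _ ⟨m, hm, rfl⟩
  exact ⟨hm, m.2⟩

/-- The cone generated by a part of a basis in terms of coordinates. -/
theorem mem_hull_basis_iff (B : Module.Basis ι ℝ V) (s : Finset ι) (w : V) :
    w ∈ PointedCone.hull ℝ (B '' (s : Set ι)) ↔
      (∀ i ∈ s, 0 ≤ B.coord i w) ∧ ∀ i ∉ s, B.coord i w = 0 := by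
  classical
  constructor
  · intro hw
    induction hw using Submodule.span_induction with
    | mem x hx =>
      obtain ⟨j, hj, rfl⟩ := hx
      refine ⟨fun i _ => ?_, fun i hi => ?_⟩
      · rw [B.coord_apply, B.repr_self, Finsupp.single_apply]
        split_ifs <;> simp
      · rw [B.coord_apply, B.repr_self, Finsupp.single_eq_of_ne]
        rintro rfl
        exact hi hj
    | zero => simp
    | add x y _ _ hx hy =>
      refine ⟨fun i hi => ?_, fun i hi => ?_⟩
      · rw [map_add]; exact add_nonneg (hx.1 i hi) (hy.1 i hi)
      · rw [map_add, hx.2 i hi, hy.2 i hi, add_zero]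
    | smul a x _ hx =>
      have h : ∀ i, B.coord i (a • x) = (a : ℝ) * B.coord i x := fun i =>
        map_smul (B.coord i) (a : ℝ) x
      refine ⟨fun i hi => ?_, fun i hi => ?_⟩
      · rw [h]; exact mul_nonneg a.2 (hx.1 i hi)
      · rw [h, hx.2 i hi, mul_zero]
  · rintro ⟨h1, h2⟩
    rw [eq_sum_coord_smul B s h2]
    exact Submodule.sum_mem _ fun i hi => Submodule.smul_mem _ (⟨B.coord i w, h1 i hi⟩ : NNReal)
      (Submodule.subset_span ⟨i, hi, rfl⟩)

/-! ### Edge vectors and values of the tangent cones. -/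

section Lattice

variable [FiniteDimensional ℝ V] {L : Submodule ℤ V} [DiscreteTopology L] [IsZLattice ℝ L]
  {P : Set V}

theorem exists_vertexFrame {v : V} (h : IsBasicCone L (tangentCone P v)) :
    ∃ (b : Module.Basis (Fin (Module.finrank ℤ L)) ℤ L)
      (Φ : VertexFrame (Fin (Module.finrank ℤ L)) P v), Φ.basis = b.ofZLatticeBasis ℝ L := by
  classical
  obtain ⟨b, s, hs⟩ := h
  refine ⟨b, ⟨b.ofZLatticeBasis ℝ L, s.toFinset, fun w => ?_⟩, rfl⟩
  rw [← mem_hull_basis_iff, hs, Set.coe_toFinset, SetLike.mem_coe]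
  simp only [Module.Basis.ofZLatticeBasis_apply]

variable {v : V} {b : Module.Basis ι ℤ L} (Φ : VertexFrame ι P v)

theorem VertexFrame.coord_coe (hb : Φ.basis = b.ofZLatticeBasis ℝ L) (m : L) (i : ι) :
    Φ.basis.coord i (m : V) = (b.repr m i : ℝ) := by
  rw [hb, Module.Basis.coord_apply, Module.Basis.ofZLatticeBasis_repr_apply]

theorem VertexFrame.basis_eq_coe (hb : Φ.basis = b.ofZLatticeBasis ℝ L) (i : ι) :
    Φ.basis i = (b i : V) := by
  rw [hb, Module.Basis.ofZLatticeBasis_apply]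

theorem VertexFrame.edgeVectors_eq (hb : Φ.basis = b.ofZLatticeBasis ℝ L) :
    edgeVectors L P v = b '' (Φ.gens : Set ι) := by
  classical
  ext l
  constructor
  · rintro ⟨hl0, hext, hmin⟩
    have hlC : (l : V) ∈ tangentCone P v := hext.subset ⟨1, zero_le_one, (one_smul _ _).symm⟩
    have hlC' := (Φ.mem_tangentCone_iff _).1 hlC
    obtain ⟨i, hi, hci⟩ : ∃ i ∈ Φ.gens, Φ.basis.coord i (l : V) ≠ 0 := by
      by_contra! hcon
      refine hl0 (Subtype.ext ?_)
      rw [Φ.eq_sum_of_coord_eq_zero Φ.gens hlC'.2]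
      exact Finset.sum_eq_zero fun i hi => by rw [hcon i hi, zero_smul]
    set c := Φ.basis.coord i (l : V) with hc
    have hcpos : 0 < c := lt_of_le_of_ne (hlC'.1 i hi) (Ne.symm hci)
    -- `l` is the midpoint of `2c • b i` and `2 • (l - c • b i)`, both in the cone, so extremality
    -- puts `b i` on the ray of `l`.
    have h1 : (2 * c) • Φ.basis i ∈ tangentCone P v :=
      (Φ.isExtreme_ray hi).subset ⟨2 * c, by positivity, rfl⟩
    have h2 : (2 : ℝ) • ((l : V) - c • Φ.basis i) ∈ tangentCone P v := by
      rw [Φ.mem_tangentCone_iff]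
      refine ⟨fun j hj => ?_, fun j hj => ?_⟩
      · rw [map_smul, map_sub, map_smul, Φ.coord_basis, smul_eq_mul]
        refine mul_nonneg zero_le_two ?_
        split_ifs with h
        · subst h; simp [hc]
        · simpa using hlC'.1 j hj
      · rw [map_smul, map_sub, map_smul, Φ.coord_basis, hlC'.2 j hj,
          if_neg (by rintro rfl; exact hj hi)]
        simp
    obtain ⟨r, hr, hrl⟩ := hext.left_mem_of_mem_openSegment h1 h2
      (⟨1, zero_le_one, (one_smul _ _).symm⟩ : (l : V) ∈ ray (l : V))
      ⟨1 / 2, 1 / 2, by norm_num, by norm_num, by norm_num, by module⟩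
    have hbi : (b i : V) ∈ ray (l : V) := by
      refine ⟨(2 * c)⁻¹ * r, by positivity, ?_⟩
      rw [mul_smul, ← hrl, smul_smul, inv_mul_cancel₀ (by positivity), one_smul,
        Φ.basis_eq_coe hb]
    obtain ⟨q, hq, hql⟩ := hmin (b i) (b.ne_zero i) hbi
    -- The coordinate of `l` is a positive integer and `q ≥ 1`, so both equal `1`: basis vectors are
    -- primitive.
    have hcoord : (1 : ℝ) = q * (b.repr l i : ℝ) := by
      have := congrArg (Φ.basis.coord i) hql
      rw [map_smul, Φ.coord_coe hb, Φ.coord_coe hb] at this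
      simpa using this
    have hqpos : 0 < q := by linarith
    have hz : (0 : ℝ) < (b.repr l i : ℝ) := by
      by_contra hcon
      nlinarith
    have hz1 : (1 : ℝ) ≤ (b.repr l i : ℝ) := by exact_mod_cast Int.cast_pos.1 hz
    have hq1 : q = 1 := by nlinarith
    rw [hq1, one_smul] at hql
    exact ⟨i, hi, Subtype.ext hql⟩
  · rintro ⟨i, hi, rfl⟩
    refine ⟨b.ne_zero i, ?_, ?_⟩
    · rw [← Φ.basis_eq_coe hb]
      exact Φ.isExtreme_ray hi
    · rintro m hm ⟨r, hr, hmr⟩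
      refine ⟨r, ?_, hmr⟩
      have hcoord : (b.repr m i : ℝ) = r := by
        have := congrArg (Φ.basis.coord i) hmr
        rw [map_smul, Φ.coord_coe hb, Φ.coord_coe hb] at this
        simpa using this
      have hr0 : r ≠ 0 := by
        rintro rfl
        exact hm (Subtype.ext (by simpa using hmr))
      have hpos : (0 : ℝ) < (b.repr m i : ℝ) := hcoord ▸ lt_of_le_of_ne hr hr0.symm
      rw [← hcoord]
      exact_mod_cast Int.cast_pos.1 hpos

theorem VertexFrame.encard_edgeVectors (hb : Φ.basis = b.ofZLatticeBasis ℝ L)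
    (hconv : Convex ℝ P) (hclosed : IsClosed P) (hv : v ∈ P) :
    (edgeVectors L P v).encard = (Module.finrank ℝ (vectorSpan ℝ P) : ℕ∞) := by
  rw [Φ.edgeVectors_eq hb, b.injective.encard_image, Set.encard_coe_eq_coe_finsetCard,
    Φ.finrank_vectorSpan hconv (self_mem_faces hconv hclosed ⟨v, hv⟩) hv, Φ.dirs_self hconv hv]

open Classical in
/-- The indicator function of the tangent cone at a vertex has the expected value. -/
theorem VertexFrame.hasValue_vertex {α : L} (Φ : VertexFrame ι P (α : V))
    (hb : Φ.basis = b.ofZLatticeBasis ℝ L) (hconv : Convex ℝ P) (hF : {(α : V)} ∈ faces P)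
    (hd : Φ.dirs {(α : V)} = ∅) (t : Torus L)
    (ht : ∀ l ∈ edgeVectors L P (α : V), ev l t ≠ 1) :
    HasValue t (fun m : L => if (m : V) ∈ faceCone P {(α : V)} then 1 else 0)
      (ev α t / ∏ᶠ l ∈ edgeVectors L P (α : V), (1 - ev l t)) := by
  rw [Φ.edgeVectors_eq hb] at ht ⊢
  rw [finprod_mem_image b.injective.injOn, finprod_mem_coe_finset]
  convert hasValue_orthant (t := t) b Φ.gens α fun i hi => ht _ ⟨i, hi, rfl⟩ using 1
  swap
  · rfl
  funext m
  refine if_congr ?_ rfl rfl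
  rw [Φ.mem_faceCone_iff hconv hF rfl, hd, and_comm, ← Submodule.coe_sub]
  simp only [Finset.notMem_empty, not_false_eq_true, true_implies, Φ.coord_coe hb,
    Int.cast_nonneg_iff, Int.cast_eq_zero]

/-- The indicator function of the tangent cone along a face of positive dimension has value `0`. -/
theorem VertexFrame.hasValue_zero_of_mem_dirs {α : L} (Φ : VertexFrame ι P (α : V))
    (hb : Φ.basis = b.ofZLatticeBasis ℝ L) (hconv : Convex ℝ P) {F : Set V} (hF : F ∈ faces P)
    (hα : (α : V) ∈ F) {j : ι} (hj : j ∈ Φ.dirs F) (t : Torus L)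
    (ht : ∀ l ∈ edgeVectors L P (α : V), ev l t ≠ 1)
    [DecidablePred fun m : L => (m : V) ∈ faceCone P F] :
    HasValue t (fun m : L => if (m : V) ∈ faceCone P F then 1 else 0) 0 := by
  classical
  -- Translation by `b j` changes only coordinate `j`, which the cone along `F` leaves
  -- unconstrained.
  refine hasValue_zero_of_invariant (g := b j) (fun m => if_congr ?_ rfl rfl)
    (ht (b j) (by rw [Φ.edgeVectors_eq hb]; exact ⟨j, Φ.dirs_subset F hj, rfl⟩))
  rw [Φ.mem_faceCone_iff hconv hF hα, Φ.mem_faceCone_iff hconv hF hα]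
  have key : ∀ i, i ≠ j → Φ.basis.coord i (((m - b j : L) : V) - α) =
      Φ.basis.coord i ((m : V) - α) := fun i hi => by
    rw [Submodule.coe_sub, ← Φ.basis_eq_coe hb, sub_right_comm, map_sub _ _ (Φ.basis j),
      Φ.coord_basis, if_neg hi, sub_zero]
  refine and_congr (forall₂_congr fun i hi => ?_) (forall₃_congr fun i _ hi => ?_)
  · rw [key i (by rintro rfl; exact hi (Φ.dirs_subset F hj))]
  · rw [key i (by rintro rfl; exact hi hj)]

end Lattice

end LatticePolytope

/-! ### Evaluating the Brianchon–Gram relation at `t`. -/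

open LatticePolytope in
theorem mainTheorem6 {V : Type*} [NormedAddCommGroup V] [NormedSpace ℝ V]
    [FiniteDimensional ℝ V] (L : Submodule ℤ V) [DiscreteTopology L] [IsZLattice ℝ L]
    (P : Set V) (hP : LatticePolytope.IsPolytopeOn L P)
    (hbasic : ∀ α ∈ LatticePolytope.vertices L P,
      LatticePolytope.IsBasicCone L (LatticePolytope.tangentCone P (α : V))) :
    (LatticePolytope.latticePoints L P).Finite ∧
    (LatticePolytope.vertices L P).Finite ∧
    (∀ α ∈ LatticePolytope.vertices L P,
      (LatticePolytope.edgeVectors L P (α : V)).encard =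
        (Module.finrank ℝ (vectorSpan ℝ P) : ℕ∞)) ∧
    ∀ t : LatticePolytope.Torus L,
      (∀ α ∈ LatticePolytope.vertices L P, ∀ l ∈ LatticePolytope.edgeVectors L P (α : V),
        LatticePolytope.ev l t ≠ 1) →
      ∑ᶠ m ∈ LatticePolytope.latticePoints L P, LatticePolytope.ev m t =
        ∑ᶠ α ∈ LatticePolytope.vertices L P,
          LatticePolytope.ev α t /
            ∏ᶠ l ∈ LatticePolytope.edgeVectors L P (α : V), (1 - LatticePolytope.ev l t) := by
  classical
  have hconv : Convex ℝ P := hP.1.convex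
  have hcomp : IsCompact P := hP.1.isCompact
  have hpts : (latticePoints L P).Finite := finite_latticePoints L hP.1.2
  have hvert : (vertices L P).Finite := hpts.subset fun α hα => hα.1
  have hext : (P.extremePoints ℝ).Finite := (hvert.image Subtype.val).subset fun v hv =>
    ⟨⟨v, hP.2 hv⟩, hv, rfl⟩
  have hfaces := finite_faces hcomp hext
  choose b Φ hΦ using fun v : P.extremePoints ℝ => exists_vertexFrame (hbasic ⟨v, hP.2 v.2⟩ v.2)
  refine ⟨hpts, hvert, fun α hα => (Φ ⟨α, hα⟩).encard_edgeVectors (hΦ ⟨α, hα⟩) hconv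
    hcomp.isClosed hα.1, fun t ht => ?_⟩
  set Z : L → ℂ := fun α => ev α t / ∏ᶠ l ∈ edgeVectors L P (α : V), (1 - ev l t)
  -- Writing each value as a sum over vertices supported on `F = {α}` lets the double sum collapse
  -- after exchanging the order.
  have hval : ∀ F ∈ hfaces.toFinset, HasValue t
      (((-1 : ℂ) ^ Module.finrank ℝ (vectorSpan ℝ F)) •
        fun m : L => if (m : V) ∈ faceCone P F then (1 : ℂ) else 0)
      (∑ α ∈ hvert.toFinset, if F = {(α : V)} then Z α else 0) := by
    intro F hF
    rw [hfaces.mem_toFinset] at hF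
    obtain ⟨v, hvF, hv⟩ := exists_extremePoint_mem_face hcomp hF
    have hrank := (Φ ⟨v, hv⟩).finrank_vectorSpan hconv hF hvF
    rcases (Φ ⟨v, hv⟩).dirs F |>.eq_empty_or_nonempty with hd | ⟨j, hj⟩
    · obtain rfl := (Φ ⟨v, hv⟩).eq_singleton_of_dirs_eq_empty hconv hF hvF hd
      rw [hrank, hd, Finset.card_empty, pow_zero, one_smul,
        Finset.sum_eq_single (⟨v, hP.2 hv⟩ : L), if_pos rfl]
      · exact VertexFrame.hasValue_vertex (α := ⟨v, hP.2 hv⟩) (Φ ⟨v, hv⟩) (hΦ ⟨v, hv⟩) hconv hF hd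
          t (ht _ hv)
      · intro α _ hne
        rw [if_neg]
        exact fun h => hne (Subtype.ext (Set.singleton_injective h).symm)
      · exact fun h => absurd (hvert.mem_toFinset.2 hv) h
    · rw [Finset.sum_eq_zero]
      · simpa only [mul_zero] using
          (VertexFrame.hasValue_zero_of_mem_dirs (α := ⟨v, hP.2 hv⟩) (Φ ⟨v, hv⟩) (hΦ ⟨v, hv⟩)
            hconv hF hvF hj t (ht _ hv)).smul ((-1 : ℂ) ^ Module.finrank ℝ (vectorSpan ℝ F))
      · intro α _
        rw [if_neg]
        rintro rfl
        rw [vectorSpan_singleton, finrank_bot, eq_comm, Finset.card_eq_zero] at hrank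
        simp [hrank] at hj
  have hsum := HasValue.sum _ hval
  have hind : (∑ F ∈ hfaces.toFinset, ((-1 : ℂ) ^ Module.finrank ℝ (vectorSpan ℝ F)) •
      fun m : L => if (m : V) ∈ faceCone P F then (1 : ℂ) else 0) =
      fun m : L => if m ∈ hpts.toFinset then 1 else 0 := by
    funext m
    have h := congrArg (Int.cast : ℤ → ℂ) (brianchon_gram Φ hcomp hconv hext hfaces (m : V))
    rw [Finset.sum_apply]
    push_cast at h
    simp only [Pi.smul_apply, smul_eq_mul, mul_ite, mul_one, mul_zero, hpts.mem_toFinset]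
    exact h
  rw [hind] at hsum
  rw [finsum_mem_eq_finite_toFinset_sum _ hpts, finsum_mem_eq_finite_toFinset_sum _ hvert]
  refine hsum.eq_sum_of_indicator.symm.trans ?_
  rw [Finset.sum_comm]
  refine Finset.sum_congr rfl fun α hα => ?_
  rw [hvert.mem_toFinset] at hα
  rw [Finset.sum_ite_eq' hfaces.toFinset, if_pos]
  exact hfaces.mem_toFinset.2 ⟨isExtreme_singleton.2 hα, convex_singleton _, isClosed_singleton,
    Set.singleton_nonempty _⟩
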